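/- **Setting.** Let $\Lambda$ be a discretely ordered abelian group (linearly ordered, with least positive element $1$), given by a computable presentation: elements are coded by natural numbers so that the group operations and the order are computable. Let $X$ be a set whose elements are coded by natural numbers and let $X^{\pm}=X\sqcup X^{-1}$. A $\Lambda$-word is a function $w:[1,|w|]\to X^{\pm}$ with $|w|\in\Lambda$, $|w|\ge 0$; concatenation $uv$ and inverse $w^{-1}(\beta)=w(|w|+1-\beta)^{-1}$ are defined as for ordinary words; $w$ is reduced if $w(\beta+1)\ne w(\beta)^{-1}$ for all $1\le\beta<|w|$, and a reduced $w$ is cyclically reduced if $w$ is empty or $w(1)^{-1}\neq w(|w|)$. $CDR(\Lambda,X)$ is the set of reduced words $w$ that can be written as a concatenation $c^{-1}uc$ with $c$ reduced and $u$ cyclically reduced. For words $u,v$, $\mathrm{com}(u,v)$ is the (if it exists, unique) word $z$ with $u=z\tilde u$, $v=z\tilde v$, where $\tilde u$ or $\tilde v$ is empty or $\tilde u(1)\ne\tilde v(1)$; put $c(u,v)=|\mathrm{com}(u,v)|$. If $u^{-1}=z\tilde u$, $v=z\tilde v$ with $z=\mathrm{com}(u^{-1},v)$, then $u*v=\tilde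 u^{-1}\tilde v$. Let $G$ be a group represented as a subgroup of $CDR(\Lambda,X)$ (all products $*$ of elements of $G$ are defined and lie in $G$, and the identity and inverses are the empty word and inverse words). Let $S_G=\{(\alpha,g): g\in G,\ 0\le\alpha\le|g|\}$, let $(\alpha,f)\sim(\beta,g)$ iff $\alpha=\beta\le c(f,g)$, and let $\Gamma_G=S_G/\!\sim$ with the metric $d(\langle\alpha,f\rangle,\langle\beta,g\rangle)=\alpha+\beta-2\min\{\alpha,\beta,c(f,g)\}$ and the action of $G$ given by $f\cdot\langle\alpha,g\rangle=\langle|f|+\alpha-2\min\{\alpha,c(f^{-1},g)\},h\rangle$, where $h=f$ if $\alpha\le c(f^{-1},g)$ and $h=f*g$ otherwise. Suppose that $G$ is generated by $y_1,\dots,y_m$ and that the representation is effective: * (ER1) each function $y_i:[1,|y_i|]\to X^{\pm}$ is computable; * (ER2) for all $i,j$, all signs $\delta,\delta'\in\{1,-1\}$ and all $\alpha\in[1,|y_i|]$, $\beta\in[1,|y_j|]$, the length $c\bigl(y_i^{\delta}|_{[\alpha,|y_i|]},\,y_j^{\delta'}|_{[\beta,|y_j|]}\bigr)$ is defined and can be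 computed from $i,j,\delta,\delta',\alpha,\beta$. Elements of $G$ are given by finite words in the letters $y_i^{\pm1}$. A representative of a point $v\in\Gamma_G$ is a pair $(\alpha,w)$ where $w$ is such a word, with value $g\in G$, $0\le\alpha\le|g|$ and $v=\langle\alpha,g\rangle$. **Theorem.** 1. $\Gamma_G$ can be constructed effectively: there is a computable infinite sequence of representatives of points of $\Gamma_G$ in which every point of $\Gamma_G$ is represented (hence appears after finitely many steps). Moreover, uniformly in a word $w$ with value $g$, the length $|g|$ and the function $g:[1,|g|]\to X^{\pm}$ are computable, and from representatives of two points of $\Gamma_G$ one can decide whether the points are equal and compute their distance. 2. The action of $G$ on $\Gamma_G$ is effective: from a word representing $f\in G$ and a representative of a point $v\in\Gamma_G$ one can compute a representative of $f\cdot v$. -/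

import Mathlib

/-! ### Discretely ordered abelian groups and computable presentations of them -/

/-- A linearly ordered abelian group is discretely ordered if it has a least positive element;
that element is written `1`. -/
class DiscretelyOrdered (Λ : Type*) [AddCommGroup Λ] [LinearOrder Λ] [IsOrderedAddMonoid Λ]
    extends One Λ where
  isLeast_one : IsLeast {a : Λ | 0 < a} 1

/-- The elements of `Λ` are coded by natural numbers (`Primcodable`), and the group operations and
the order are computable on codes. -/
class ComputableOrderedGroup (Λ : Type*) [AddCommGroup Λ] [LinearOrder Λ] [IsOrderedAddMonoid Λ]
    [Primcodable Λ] : Prop where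
  add : Computable₂ fun a b : Λ => a + b
  neg : Computable fun a : Λ => -a
  le : ComputablePred fun p : Λ × Λ => p.1 ≤ p.2

/-! ### Infinite words -/

/-- The alphabet `X ∪ X⁻¹`: `(x, true)` is `x` and `(x, false)` is `x⁻¹`. -/
abbrev Letter (X : Type*) := X × Bool

/-- The formal inverse of a letter. -/
def Letter.inv {X : Type*} (x : Letter X) : Letter X := (x.1, !x.2)

section Words

variable {Λ : Type*} [AddCommGroup Λ] [LinearOrder Λ] [IsOrderedAddMonoid Λ] [DiscretelyOrdered Λ]
variable {X : Type*}

theorem DiscretelyOrdered.one_le_iff {a : Λ} : 1 ≤ a ↔ 0 < a :=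
  ⟨fun h => lt_of_lt_of_le (DiscretelyOrdered.isLeast_one (Λ := Λ)).1 h,
   fun h => (DiscretelyOrdered.isLeast_one (Λ := Λ)).2 h⟩

theorem DiscretelyOrdered.one_pos' : (0 : Λ) < 1 := one_le_iff.1 le_rfl

theorem DiscretelyOrdered.add_one_le_iff {a b : Λ} : a + 1 ≤ b ↔ a < b := by
  rw [← sub_pos, ← one_le_iff, le_sub_iff_add_le, add_comm]

theorem DiscretelyOrdered.lt_add_one_iff {a b : Λ} : a < b + 1 ↔ a ≤ b := by
  rw [← not_le, add_one_le_iff, not_lt]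

variable (Λ X) in
/-- A `Λ`-word over `X`: a function from the closed segment `[1, len]` of `Λ` to `X ∪ X⁻¹`, where
`0 ≤ len`. It is given as a partial function on `Λ` (the value `none` means undefined) whose domain
is exactly this segment. -/
@[ext]
structure LWord where
  len : Λ
  letter : Λ → Option (Letter X)
  len_nonneg : 0 ≤ len
  isSome_iff : ∀ a, (letter a).isSome ↔ 1 ≤ a ∧ a ≤ len

namespace LWord

open DiscretelyOrdered

/-- The empty word. -/
def empty : LWord Λ X where
  len := 0
  letter _ := none
  len_nonneg := le_rfl
  isSome_iff a := by
    simp only [Option.isSome_none, Bool.false_eq_true, false_iff, not_and, not_le, one_le_iff]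
    exact id

/-- Concatenation of words. -/
def concat (u v : LWord Λ X) : LWord Λ X where
  len := u.len + v.len
  letter a := if a ≤ u.len then u.letter a else v.letter (a - u.len)
  len_nonneg := add_nonneg u.len_nonneg v.len_nonneg
  isSome_iff a := by
    have hu := u.len_nonneg
    have hv := v.len_nonneg
    split_ifs with h
    · rw [u.isSome_iff]
      exact ⟨fun k => ⟨k.1, k.2.trans (le_add_of_nonneg_right hv)⟩, fun k => ⟨k.1, h⟩⟩
    · rw [v.isSome_iff, one_le_iff, one_le_iff, sub_pos, sub_le_iff_le_add']
      rw [not_le] at h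
      exact ⟨fun k => ⟨hu.trans_lt h, k.2⟩, fun k => ⟨h, k.2⟩⟩

/-- The inverse word: `w⁻¹(β) = w(|w| + 1 - β)⁻¹`. -/
def inv (w : LWord Λ X) : LWord Λ X where
  len := w.len
  letter b := (w.letter (w.len + 1 - b)).map Letter.inv
  len_nonneg := w.len_nonneg
  isSome_iff b := by
    rw [Option.isSome_map, w.isSome_iff, le_sub_iff_add_le, add_comm 1 b, add_le_add_iff_right,
      sub_le_iff_le_add, add_le_add_iff_left, and_comm]

/-- The restriction of `w` to `[α, |w|]`, reindexed as a word of length `|w| + 1 - α`. -/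
def tail (w : LWord Λ X) (α : Λ) (hα : α ∈ Set.Icc 1 w.len) : LWord Λ X where
  len := w.len + 1 - α
  letter b := if 1 ≤ b then w.letter (α + b - 1) else none
  len_nonneg := sub_nonneg.2 (hα.2.trans (le_add_of_nonneg_right one_pos'.le))
  isSome_iff b := by
    split_ifs with h
    · rw [w.isSome_iff, le_sub_iff_add_le, sub_le_iff_le_add, le_sub_iff_add_le']
      exact ⟨fun k => ⟨h, k.2⟩, fun k => ⟨add_le_add hα.1 h, k.2⟩⟩
    · simp [h]

/-- A word is reduced if `w(β + 1) ≠ w(β)⁻¹` for all `1 ≤ β < |w|`. -/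
def IsReduced (w : LWord Λ X) : Prop :=
  ∀ b, 1 ≤ b → b < w.len → w.letter (b + 1) ≠ (w.letter b).map Letter.inv

/-- A reduced word `w` is cyclically reduced if `w(1)⁻¹ ≠ w(|w|)` (no condition if `w` is
empty). -/
def IsCyclicallyReduced (w : LWord Λ X) : Prop :=
  w.IsReduced ∧ (0 < w.len → (w.letter 1).map Letter.inv ≠ w.letter w.len)

/-- Membership in `CDR(Λ, X)`: the reduced words `w` with a cyclic decomposition
`w = c⁻¹ ∘ u ∘ c`. -/
def IsCDR (w : LWord Λ X) : Prop :=
  w.IsReduced ∧ ∃ c u : LWord Λ X, c.IsReduced ∧ u.IsCyclicallyReduced ∧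
    w = (c.inv.concat u).concat c

/-- The first letters of `u` and `v` are not equal (which holds if one of the words is empty). -/
def Diverge (u v : LWord Λ X) : Prop :=
  u.len = 0 ∨ v.len = 0 ∨ u.letter 1 ≠ v.letter 1

/-- `w` is the longest common initial segment `com(u, v)` of `u` and `v`. -/
def IsCom (u v w : LWord Λ X) : Prop :=
  ∃ u' v' : LWord Λ X, u = w.concat u' ∧ v = w.concat v' ∧ u'.Diverge v'

/-- `u * v` is defined and equals `w`: if `u⁻¹ = z ∘ u'` and `v = z ∘ v'` with
`z = com(u⁻¹, v)`, then `u * v = u'⁻¹ ∘ v'`. -/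
def IsProd (u v w : LWord Λ X) : Prop :=
  ∃ z u' v' : LWord Λ X, u.inv = z.concat u' ∧ v = z.concat v' ∧ u'.Diverge v' ∧
    w = u'.inv.concat v'

open Classical in
/-- `c(u, v)` is the length of `com(u, v)` (and `0` if `com(u, v)` is not defined). -/
noncomputable def comLen (u v : LWord Λ X) : Λ :=
  if h : ∃ w, IsCom u v w then h.choose.len else 0

theorem letter_eq_none {w : LWord Λ X} {a : Λ} (h : ¬ (1 ≤ a ∧ a ≤ w.len)) :
    w.letter a = none := by
  rw [← w.isSome_iff] at h
  simpa using h

theorem letter_ne_none {w : LWord Λ X} {a : Λ} (h1 : 1 ≤ a) (h : a ≤ w.len) :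
    w.letter a ≠ none := by
  have := (w.isSome_iff a).2 ⟨h1, h⟩
  intro h'
  simp [h'] at this

theorem inv_inv (w : LWord Λ X) : w.inv.inv = w := by
  ext1
  · rfl
  · funext a
    have h' : Letter.inv ∘ Letter.inv = (id : Letter X → Letter X) := by
      funext x; simp [Letter.inv]
    simp [inv, h']

/-- The letterwise description of `com(u, v)`. -/
theorem IsCom.spec {u v w : LWord Λ X} (h : IsCom u v w) :
    w.len ≤ u.len ∧ w.len ≤ v.len ∧ (∀ a ≤ w.len, u.letter a = v.letter a) ∧
    (w.len < u.len → w.len < v.len → u.letter (w.len + 1) ≠ v.letter (w.len + 1)) := by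
  obtain ⟨u', v', rfl, rfl, hd⟩ := h
  refine ⟨le_add_of_nonneg_right u'.len_nonneg, le_add_of_nonneg_right v'.len_nonneg, ?_, ?_⟩
  · intro a ha
    simp [concat, ha]
  · intro h1 h2
    have hn : ¬ w.len + 1 ≤ w.len := not_le.2 (lt_add_of_pos_right _ one_pos')
    simp only [concat, hn, if_false, add_sub_cancel_left]
    simp only [concat, lt_add_iff_pos_right] at h1 h2
    rcases hd with hd | hd | hd
    · exact absurd hd h1.ne'
    · exact absurd hd h2.ne'
    · exact hd

/-- An initial segment along which the words agree is no longer than `com(u, v)`. -/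
theorem IsCom.le_of_agree {u v w : LWord Λ X} (h : IsCom u v w) {s : Λ} (hu : s ≤ u.len)
    (hv : s ≤ v.len) (hs : ∀ a ≤ s, u.letter a = v.letter a) : s ≤ w.len := by
  by_contra hlt
  rw [not_le] at hlt
  exact h.spec.2.2.2 (hlt.trans_le hu) (hlt.trans_le hv) (hs _ (add_one_le_iff.2 hlt))

theorem IsCom.comLen_eq {u v w : LWord Λ X} (h : IsCom u v w) : comLen u v = w.len := by
  have hex : ∃ w, IsCom u v w := ⟨w, h⟩
  have h' := hex.choose_spec
  rw [comLen, dif_pos hex]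
  exact le_antisymm (h.le_of_agree h'.spec.1 h'.spec.2.1 h'.spec.2.2.1)
    (h'.le_of_agree h.spec.1 h.spec.2.1 h.spec.2.2.1)

theorem IsProd.isCom {u v w : LWord Λ X} (h : IsProd u v w) : ∃ z, IsCom u.inv v z := by
  obtain ⟨z, u', v', h1, h2, h3, -⟩ := h
  exact ⟨z, u', v', h1, h2, h3⟩

/-- The letterwise description of `u * v`. -/
theorem IsProd.spec {u v w : LWord Λ X} (h : IsProd u v w) :
    w.len = u.len + v.len - 2 • comLen u.inv v ∧
    ∀ a, w.letter a = if a ≤ u.len - comLen u.inv v then u.letter a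
      else v.letter (a - u.len + 2 • comLen u.inv v) := by
  obtain ⟨z, u', v', h1, h2, h3, rfl⟩ := h
  have hc : comLen u.inv v = z.len := IsCom.comLen_eq ⟨u', v', h1, h2, h3⟩
  have hu : u = (z.concat u').inv := by rw [← h1, inv_inv]
  have hul : u.len = z.len + u'.len := by rw [hu]; rfl
  have hvl : v.len = z.len + v'.len := by rw [h2]; rfl
  rw [hc]
  constructor
  · change u'.len + v'.len = _
    rw [hul, hvl]; abel
  · intro a
    have e1 : u.len - z.len = u'.len := by rw [hul]; abel
    rw [e1]
    change (if a ≤ u'.len then u'.inv.letter a else v'.letter (a - u'.len)) = _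
    split_ifs with ha
    · rw [hu]
      have hn : ¬ (z.len + u'.len + 1 - a ≤ z.len) := by
        rw [not_le, lt_sub_iff_add_lt, add_assoc, add_lt_add_iff_left]
        exact lt_add_one_iff.2 ha
      have e2 : z.len + u'.len + 1 - a - z.len = u'.len + 1 - a := by abel
      simp only [inv, concat, hn, if_false, e2]
    · rw [not_le] at ha
      have e3 : a - u.len + 2 • z.len = a - u'.len + z.len := by rw [hul]; abel
      have hn : ¬ (a - u'.len + z.len ≤ z.len) := by
        rw [not_le]
        exact lt_add_of_pos_left _ (sub_pos.2 ha)
      rw [e3, h2]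
      simp only [concat, hn, if_false, add_sub_cancel_right]

end LWord

/-! ### Groups of infinite words and the tree `Γ_G` -/

variable (Λ X) in
/-- A representation of the group `G` as a subgroup of `CDR(Λ, X)`: an injective map into
`CDR(Λ, X)` that takes the identity to the empty word, inverses to inverse words, and such that the
product `*` of any two words of the image is defined and is the image of the product in `G`. -/
structure WordGroup (G : Type*) [Group G] where
  word : G → LWord Λ X
  injective : Function.Injective word
  isCDR : ∀ g, (word g).IsCDR
  map_one : word 1 = LWord.empty
  map_inv : ∀ g, word g⁻¹ = (word g).inv
  map_mul : ∀ f g, LWord.IsProd (word f) (word g) (word (f * g))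

namespace WordGroup

open LWord

variable {G : Type*} [Group G] (ρ : WordGroup Λ X G)

/-- The length `|g|` of (the word of) `g`. -/
def len (g : G) : Λ := (ρ.word g).len

/-- `c(f, g)`, the length of the longest common initial segment of `f` and `g`. -/
noncomputable def c (f g : G) : Λ := comLen (ρ.word f) (ρ.word g)

theorem exists_isCom (f g : G) : ∃ w, IsCom (ρ.word f) (ρ.word g) w := by
  have h := (ρ.map_mul f⁻¹ g).isCom
  rwa [ρ.map_inv, LWord.inv_inv] at h

theorem c_le_left (f g : G) : ρ.c f g ≤ ρ.len f := by
  obtain ⟨w, hw⟩ := ρ.exists_isCom f g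
  rw [c, hw.comLen_eq]; exact hw.spec.1

theorem c_le_right (f g : G) : ρ.c f g ≤ ρ.len g := by
  obtain ⟨w, hw⟩ := ρ.exists_isCom f g
  rw [c, hw.comLen_eq]; exact hw.spec.2.1

theorem c_nonneg (f g : G) : 0 ≤ ρ.c f g := by
  obtain ⟨w, hw⟩ := ρ.exists_isCom f g
  rw [c, hw.comLen_eq]; exact w.len_nonneg

/-- `s ≤ c(f, g)` if and only if `f` and `g` agree on `[1, s]`. -/
theorem le_c_iff (f g : G) (s : Λ) : s ≤ ρ.c f g ↔ s ≤ ρ.len f ∧ s ≤ ρ.len g ∧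
    ∀ a ≤ s, (ρ.word f).letter a = (ρ.word g).letter a := by
  obtain ⟨w, hw⟩ := ρ.exists_isCom f g
  rw [c, hw.comLen_eq]
  exact ⟨fun h => ⟨h.trans hw.spec.1, h.trans hw.spec.2.1,
    fun a ha => hw.spec.2.2.1 a (ha.trans h)⟩, fun h => hw.le_of_agree h.1 h.2.1 h.2.2⟩

theorem c_comm (f g : G) : ρ.c f g = ρ.c g f := by
  have key : ∀ f g, ρ.c f g ≤ ρ.c g f := fun f g => by
    have h := (ρ.le_c_iff f g _).1 le_rfl
    exact (ρ.le_c_iff g f _).2 ⟨h.2.1, h.1, fun a ha => (h.2.2 a ha).symm⟩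
  exact le_antisymm (key f g) (key g f)

theorem le_c_self {g : G} {a : Λ} (h : a ≤ ρ.len g) : a ≤ ρ.c g g :=
  (ρ.le_c_iff g g a).2 ⟨h, h, fun _ _ => rfl⟩

theorem le_c_trans {f g h : G} {s : Λ} (h1 : s ≤ ρ.c f g) (h2 : s ≤ ρ.c g h) : s ≤ ρ.c f h := by
  rw [le_c_iff] at h1 h2 ⊢
  exact ⟨h1.1, h2.2.1, fun a ha => (h1.2.2 a ha).trans (h2.2.2 a ha)⟩

/-- The set `S_G` of pairs `(α, g)` with `α ∈ [0, |g|]`. -/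
abbrev PreTree : Type _ := {p : Λ × G // 0 ≤ p.1 ∧ p.1 ≤ ρ.len p.2}

/-- `(α, f) ∼ (β, g)` if and only if `α = β ∈ [0, c(f, g)]`. -/
instance preTreeSetoid : Setoid ρ.PreTree where
  r p q := p.1.1 = q.1.1 ∧ 0 ≤ p.1.1 ∧ p.1.1 ≤ ρ.c p.1.2 q.1.2
  iseqv :=
    { refl := fun p => ⟨rfl, p.2.1, ρ.le_c_self p.2.2⟩
      symm := fun {p q} h => ⟨h.1.symm, q.2.1, by rw [c_comm, ← h.1]; exact h.2.2⟩
      trans := fun {p q r} h k => ⟨h.1.trans k.1, h.2.1,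
        ρ.le_c_trans h.2.2 (by rw [h.1]; exact k.2.2)⟩ }

/-- The universal tree `Γ_G = S_G / ∼`. -/
def Tree : Type _ := Quotient ρ.preTreeSetoid

/-- The point `⟨α, g⟩` of `Γ_G`. -/
def point (α : Λ) (g : G) (h0 : 0 ≤ α) (h : α ≤ ρ.len g) : ρ.Tree := ⟦⟨(α, g), h0, h⟩⟧

theorem min_c_le {f g u v : G} {a b : Λ} (h1 : a ≤ ρ.c f u) (h2 : b ≤ ρ.c g v) :
    min (min a b) (ρ.c f g) ≤ min (min a b) (ρ.c u v) := by
  refine le_min (min_le_left _ _) ?_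
  have e1 : min (min a b) (ρ.c f g) ≤ ρ.c u f := by
    rw [ρ.c_comm u f]; exact ((min_le_left _ _).trans (min_le_left _ _)).trans h1
  have e2 : min (min a b) (ρ.c f g) ≤ ρ.c g v :=
    ((min_le_left _ _).trans (min_le_right _ _)).trans h2
  exact ρ.le_c_trans (ρ.le_c_trans e1 (min_le_right _ _)) e2

/-- The metric of `Γ_G`:
`d(⟨α, f⟩, ⟨β, g⟩) = α + β - 2 min {α, β, c(f, g)}`. -/
noncomputable def dist : ρ.Tree → ρ.Tree → Λ :=
  Quotient.lift₂
    (fun p q => p.1.1 + q.1.1 - 2 • min (min p.1.1 q.1.1) (ρ.c p.1.2 q.1.2))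
    (by
      rintro ⟨⟨a, f⟩, hf⟩ ⟨⟨b, g⟩, hg⟩ ⟨⟨a', u⟩, hu⟩ ⟨⟨b', v⟩, hv⟩ ⟨e1, -, k1⟩ ⟨e2, -, k2⟩
      dsimp only at e1 e2 k1 k2 ⊢
      subst e1 e2
      rw [le_antisymm (ρ.min_c_le k1 k2)
        (ρ.min_c_le (by rwa [c_comm]) (by rwa [c_comm]))])

theorem len_mul (f g : G) : ρ.len (f * g) = ρ.len f + ρ.len g - 2 • ρ.c f⁻¹ g := by
  rw [c, map_inv]; exact (ρ.map_mul f g).spec.1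

theorem letter_mul (f g : G) (a : Λ) : (ρ.word (f * g)).letter a =
    if a ≤ ρ.len f - ρ.c f⁻¹ g then (ρ.word f).letter a
      else (ρ.word g).letter (a - ρ.len f + 2 • ρ.c f⁻¹ g) := by
  rw [c, map_inv]; exact (ρ.map_mul f g).spec.2 a

theorem len_inv (f : G) : ρ.len f⁻¹ = ρ.len f := by
  rw [len, map_inv]; rfl

theorem actPre_mem_left {f g : G} {a : Λ} (h0 : 0 ≤ a) (h : a ≤ ρ.c f⁻¹ g) :
    0 ≤ ρ.len f + a - 2 • min a (ρ.c f⁻¹ g) ∧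
      ρ.len f + a - 2 • min a (ρ.c f⁻¹ g) ≤ ρ.len f := by
  have e : ρ.len f + a - 2 • min a (ρ.c f⁻¹ g) = ρ.len f - a := by rw [min_eq_left h]; abel
  rw [e]
  exact ⟨sub_nonneg.2 (by rw [← ρ.len_inv]; exact h.trans (ρ.c_le_left _ _)),
    sub_le_self _ h0⟩

theorem actPre_mem_right {f g : G} {a : Λ} (ha : a ≤ ρ.len g) (h : ¬ a ≤ ρ.c f⁻¹ g) :
    0 ≤ ρ.len f + a - 2 • min a (ρ.c f⁻¹ g) ∧
      ρ.len f + a - 2 • min a (ρ.c f⁻¹ g) ≤ ρ.len (f * g) := by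
  rw [not_le] at h
  rw [min_eq_right h.le, len_mul, two_nsmul]
  refine ⟨sub_nonneg.2 (add_le_add ?_ h.le), sub_le_sub_right (by gcongr) _⟩
  rw [← ρ.len_inv]; exact ρ.c_le_left _ _

open Classical in
/-- The action of `f` on representatives: the first coordinate of `f · (α, g)` is
`|f| + α - 2 min {α, c(f⁻¹, g)}`, the second one is `f` if `α ≤ c(f⁻¹, g)` and `f * g`
otherwise. -/
noncomputable def actPre (f : G) (p : ρ.PreTree) : ρ.PreTree :=
  if h : p.1.1 ≤ ρ.c f⁻¹ p.1.2 then
    ⟨(ρ.len f + p.1.1 - 2 • min p.1.1 (ρ.c f⁻¹ p.1.2), f), ρ.actPre_mem_left p.2.1 h⟩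
  else
    ⟨(ρ.len f + p.1.1 - 2 • min p.1.1 (ρ.c f⁻¹ p.1.2), f * p.1.2), ρ.actPre_mem_right p.2.2 h⟩

theorem actPre_congr (f : G) {p q : ρ.PreTree} (h : p ≈ q) : ρ.actPre f p ≈ ρ.actPre f q := by
  obtain ⟨⟨a, g⟩, hp⟩ := p
  obtain ⟨⟨b, k⟩, hq⟩ := q
  obtain ⟨e, -, hc⟩ := h
  dsimp only at e hc hp hq
  subst e
  by_cases h1 : a ≤ ρ.c f⁻¹ g
  · have h2 : a ≤ ρ.c f⁻¹ k := ρ.le_c_trans h1 hc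
    have : ρ.actPre f ⟨(a, g), hp⟩ = ρ.actPre f ⟨(a, k), hq⟩ := by
      simp [actPre, h1, h2]
    rw [this]
  · have h2 : ¬ a ≤ ρ.c f⁻¹ k := fun h2 => h1 (ρ.le_c_trans h2 (by rwa [c_comm]))
    have e : ρ.c f⁻¹ g = ρ.c f⁻¹ k := by
      rw [not_le] at h1 h2
      exact le_antisymm (ρ.le_c_trans le_rfl (h1.le.trans hc))
        (ρ.le_c_trans le_rfl (h2.le.trans (by rwa [c_comm])))
    have m1 := ρ.actPre_mem_right hp.2 h1
    have m2 := ρ.actPre_mem_right hq.2 h2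
    simp only [actPre, h1, h2, dif_neg, not_false_eq_true]
    refine ⟨by dsimp only; rw [e], m1.1, ?_⟩
    dsimp only
    rw [← e] at m2
    rw [le_c_iff]
    refine ⟨m1.2, m2.2, fun s hs => ?_⟩
    rw [letter_mul, letter_mul, ← e]
    split_ifs with h3
    · rfl
    · refine ((ρ.le_c_iff g k a).1 hc).2.2 _ ?_
      rw [min_eq_right (not_le.1 h1).le] at hs
      have := add_le_add_left hs (-ρ.len f + 2 • ρ.c f⁻¹ g)
      calc s - ρ.len f + 2 • ρ.c f⁻¹ g = s + (-ρ.len f + 2 • ρ.c f⁻¹ g) := by abel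
        _ ≤ _ := this
        _ = a := by abel

/-- The action of `G` on `Γ_G`. -/
noncomputable instance : SMul G ρ.Tree :=
  ⟨fun f => Quotient.map (ρ.actPre f) fun _ _ h => ρ.actPre_congr f h⟩

end WordGroup

/-! ### Effective representations -/

variable {G : Type*} [Group G] {m : ℕ}

/-- The element of `G` given by a finite word in the generators `y i` and their inverses
(`(i, true)` stands for `y i` and `(i, false)` for its inverse). -/
def genProd (y : Fin m → G) (w : List (Fin m × Bool)) : G :=
  (w.map fun p => if p.2 then y p.1 else (y p.1)⁻¹).prod

/-- The group `G = ⟨y 0, …, y (m - 1)⟩` of `Λ`-words is effectively represented. -/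
structure IsEffectiveRep [Primcodable Λ] [Primcodable X] (ρ : WordGroup Λ X G)
    (y : Fin m → G) : Prop where
  generates : Subgroup.closure (Set.range y) = ⊤
  /-- Each generator is a computable function on its segment. -/
  letter_computable : ∀ i, Computable (ρ.word (y i)).letter
  /-- For all tails `h₁`, `h₂` of the words `(y i)^{±1}`, `(y j)^{±1}`, the length `c(h₁, h₂)` is
  computed from `i`, `j`, the signs and the starting positions of the tails. -/
  com_computable : ∃ C : (Fin m × Bool) × Λ → (Fin m × Bool) × Λ → Λ, Computable₂ C ∧
    ∀ (p q : Fin m × Bool) (α β : Λ)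
      (hα : α ∈ Set.Icc 1 (ρ.word (genProd y [p])).len)
      (hβ : β ∈ Set.Icc 1 (ρ.word (genProd y [q])).len),
      ∃ w, LWord.IsCom ((ρ.word (genProd y [p])).tail α hα) ((ρ.word (genProd y [q])).tail β hβ) w ∧
        C (p, α) (q, β) = w.len

/-- The pair `r = (α, w)`, where `w` is a finite word in the generators with value `g`, is a
representative of the point `v` of `Γ_G`: `α ∈ [0, |g|]` and `v = ⟨α, g⟩`. -/
def Represents (ρ : WordGroup Λ X G) (y : Fin m → G) (r : Λ × List (Fin m × Bool))
    (v : ρ.Tree) : Prop :=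
  ∃ (h0 : 0 ≤ r.1) (h : r.1 ≤ ρ.len (genProd y r.2)), v = ρ.point r.1 (genProd y r.2) h0 h

end Words

/-! Every element of `G` is a finite concatenation of subwords of the generators and their inverses,
and such a concatenation is finite data: a list of segments `(p, a, b)`. These lists are closed
under inversion, which reverses the list and reflects each segment, and under the product `*`. To
multiply, the inverse of the first list is compared with the second. At each step (ER2) gives the
common length of the tails at which the two leading segments start, and this length is cut down to
the shorter of the two segments. Either a mismatch occurs strictly inside both segments, and then
the longest common initial segment has been found, or at least one segment is used up
(`diverge_or_length_lt_of_compareStep`). The total number of segments therefore bounds the number of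
steps, and `IsState.iterate` turns this into the correctness of `compare`.

What remains of the two lists after the comparison is exactly the pair of factors in the definition
of `*` (`isProd_mulList`). Since the product of two words is unique, multiplying out a word in the
generators computes a list for its value in `G` (`normalForm_spec`). Lengths are then sums of
segment lengths, letters are found by locating the segment that contains the position and using
(ER1), and `c(f, g)` is the first output of `compare`.

Equality of points, the metric and the action are given by formulas in lengths and values of `c`.
Points are enumerated by running through all codes of pairs `(α, w)` and testing `0 ≤ α ≤ |g|`. -/

namespace Computable

/-! ### Closure properties of computable functions: iteration, folds, finite families. -/

variable {α β σ : Type*} [Primcodable α] [Primcodable β] [Primcodable σ]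

theorem list_head? : Computable (@List.head? α) := Primrec.list_head?.to_comp

theorem list_tail : Computable (@List.tail α) := Primrec.list_tail.to_comp

theorem nat_iterate {f : α → ℕ} {g : α → σ} {h : α → σ → σ} (hf : Computable f)
    (hg : Computable g) (hh : Computable₂ h) : Computable fun a => (h a)^[f a] (g a) :=
  (nat_rec hf hg (hh.comp fst (snd.comp snd)).to₂).of_eq fun a => by
    induction f a with
    | zero => rfl
    | succ n ih => rw [Function.iterate_succ_apply', ← ih]

/-- The fold is a recursion on the index into the list `f a`; stage `n` is the fold over its first
`n` entries. The branch for a missing entry, which keeps the state, is never reached for indices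
below the length. -/
theorem list_foldl {f : α → List β} {g : α → σ} {h : α → σ × β → σ} (hf : Computable f)
    (hg : Computable g) (hh : Computable₂ h) :
    Computable fun a => (f a).foldl (fun s b => h a (s, b)) (g a) := by
  have hstep : Computable₂ fun (a : α) (p : ℕ × σ) =>
      (Option.casesOn ((f a)[p.1]?) p.2 (fun b => h a (p.2, b)) : σ) :=
    option_casesOn (list_getElem?.comp (hf.comp fst) (fst.comp snd)) (snd.comp snd)
      (hh.comp (fst.comp fst) (pair (snd.comp (snd.comp fst)) snd)).to₂
  refine (nat_rec (list_length.comp hf) hg hstep).of_eq fun a => ?_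
  have key : ∀ n ≤ (f a).length, (Nat.rec (motive := fun _ => σ) (g a)
      (fun i s => Option.casesOn ((f a)[i]?) s (fun b => h a (s, b))) n) =
      ((f a).take n).foldl (fun s b => h a (s, b)) (g a) := by
    intro n
    induction n with
    | zero => intro _; simp
    | succ n ih =>
      intro hn
      have hn' : n < (f a).length := hn
      rw [← List.take_concat_get' _ _ hn', List.foldl_append, ← ih hn'.le]
      simp [hn']
  simpa using key _ le_rfl

theorem list_foldr {f : α → List β} {g : α → σ} {h : α → β × σ → σ} (hf : Computable f)
    (hg : Computable g) (hh : Computable₂ h) :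
    Computable fun a => (f a).foldr (fun b s => h a (b, s)) (g a) :=
  (list_foldl (list_reverse.comp hf) hg
    (hh.comp fst (pair (snd.comp snd) (fst.comp snd))).to₂).of_eq fun a => by simp

theorem list_map {f : α → List β} {g : α → β → σ} (hf : Computable f) (hg : Computable₂ g) :
    Computable fun a => (f a).map (g a) :=
  (list_foldr hf (const []) (list_cons.comp (hg.comp fst (fst.comp snd)) (snd.comp snd)).to₂).of_eq
    fun a => by induction f a <;> simp_all

theorem ite {c : α → Prop} [DecidablePred c] {f g : α → σ}
    (hc : Computable fun a => decide (c a)) (hf : Computable f) (hg : Computable g) :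
    Computable fun a => if c a then f a else g a :=
  (cond hc hf hg).of_eq fun a => by by_cases h : c a <;> simp [h]

/-- A finite family of computable functions is uniformly computable. -/
theorem uncurry_of_finite [Finite β] {f : β → α → σ} (hf : ∀ b, Computable (f b)) :
    Computable₂ f := by
  obtain ⟨n, ⟨e⟩⟩ := Finite.exists_equiv_fin β
  exact (vector_get.comp ((vector_ofFn fun i => hf (e.symm i)).comp snd)
    -- The values of all members of the family at the argument form a vector of fixed length, and
    -- the index selects an entry.
    ((Primrec.dom_finite e).to_comp.comp fst)).of_eq fun p => by simp

end Computable

/-! ### Computable arithmetic and order in `Λ`. -/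

namespace ComputableOrderedGroup

variable {Λ : Type*} [AddCommGroup Λ] [LinearOrder Λ] [IsOrderedAddMonoid Λ] [Primcodable Λ]
  [ComputableOrderedGroup Λ] {α : Type*} [Primcodable α] {f g : α → Λ}

theorem computable_add (hf : Computable f) (hg : Computable g) : Computable fun a => f a + g a :=
  add.comp hf hg

theorem computable_sub (hf : Computable f) (hg : Computable g) : Computable fun a => f a - g a :=
  (add.comp hf (neg.comp hg)).of_eq fun a => (sub_eq_add_neg (f a) (g a)).symm

theorem computable_le (hf : Computable f) (hg : Computable g) :
    Computable fun a => decide (f a ≤ g a) :=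
  (le (Λ := Λ)).decide.comp (hf.pair hg)

theorem computable_lt (hf : Computable f) (hg : Computable g) :
    Computable fun a => decide (f a < g a) :=
  (Primrec.not.to_comp.comp (computable_le hg hf)).of_eq fun a => by
    simp [← decide_not]

theorem computable_min (hf : Computable f) (hg : Computable g) :
    Computable fun a => min (f a) (g a) :=
  (Computable.ite (computable_le hf hg) hf hg).of_eq fun a => (min_def (f a) (g a)).symm

end ComputableOrderedGroup

/-! ### Algebra of words: concatenation, inversion and subwords. -/

namespace LWord

open DiscretelyOrdered

variable {Λ : Type*} [AddCommGroup Λ] [LinearOrder Λ] [IsOrderedAddMonoid Λ] [DiscretelyOrdered Λ]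
variable {X : Type*}

theorem letter_of_nonpos (w : LWord Λ X) {a : Λ} (h : a ≤ 0) : w.letter a = none :=
  letter_eq_none fun k => (one_pos'.trans_le k.1).not_ge h

theorem concat_letter_of_le {u v : LWord Λ X} {a : Λ} (h : a ≤ u.len) :
    (u.concat v).letter a = u.letter a := if_pos h

theorem concat_letter_of_lt {u v : LWord Λ X} {a : Λ} (h : u.len < a) :
    (u.concat v).letter a = v.letter (a - u.len) := if_neg h.not_ge

theorem empty_concat (w : LWord Λ X) : empty.concat w = w := by
  ext1
  · exact zero_add _
  · funext a
    change (if a ≤ 0 then none else w.letter (a - 0)) = _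
    split_ifs with h
    · rw [w.letter_of_nonpos h]
    · rw [sub_zero]

theorem concat_empty (w : LWord Λ X) : w.concat empty = w := by
  ext1
  · exact add_zero _
  · funext a
    change (if a ≤ w.len then w.letter a else none) = _
    split_ifs with h
    · rfl
    · exact (letter_eq_none fun k => h k.2).symm

theorem concat_assoc (u v w : LWord Λ X) : (u.concat v).concat w = u.concat (v.concat w) := by
  ext1
  · exact add_assoc _ _ _
  · funext a
    change (if a ≤ u.len + v.len then (if a ≤ u.len then u.letter a else v.letter (a - u.len))
      else w.letter (a - (u.len + v.len))) = (if a ≤ u.len then u.letter a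
        else if a - u.len ≤ v.len then v.letter (a - u.len) else w.letter (a - u.len - v.len))
    rw [sub_sub]
    by_cases h : a ≤ u.len
    · simp [h, h.trans (le_add_of_nonneg_right v.len_nonneg)]
    · simp [h, add_comm v.len]

theorem inv_concat (u v : LWord Λ X) : (u.concat v).inv = v.inv.concat u.inv := by
  ext1
  · exact add_comm _ _
  · funext a
    change Option.map _ (if u.len + v.len + 1 - a ≤ u.len then u.letter (u.len + v.len + 1 - a)
      else v.letter (u.len + v.len + 1 - a - u.len)) = if a ≤ v.len then
        Option.map _ (v.letter (v.len + 1 - a)) else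
        Option.map _ (u.letter (u.len + 1 - (a - v.len)))
    have e1 : u.len + v.len + 1 - a - u.len = v.len + 1 - a := by abel
    have e2 : u.len + 1 - (a - v.len) = u.len + v.len + 1 - a := by abel
    have e3 : u.len + v.len + 1 - a ≤ u.len ↔ ¬ a ≤ v.len := by
      rw [not_le, ← add_one_le_iff, sub_le_iff_le_add, add_assoc, add_le_add_iff_left]
    rw [e1, e2]
    by_cases h : a ≤ v.len
    · rw [if_neg (by rwa [e3, not_not]), if_pos h]
    · rw [if_pos (e3.2 h), if_neg h]

theorem eq_empty_of_len {w : LWord Λ X} (h : w.len = 0) : w = empty := by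
  ext1
  · exact h
  · funext a
    exact letter_eq_none fun k => (one_pos'.trans_le (k.1.trans k.2)).ne' h

/-- `IsProd.spec` expresses the length and the letters of the product through `u`, `v` and `comLen`
alone. This is what identifies a product computed on segments with the product in `G`. -/
theorem IsProd.unique {u v w w' : LWord Λ X} (h : IsProd u v w) (h' : IsProd u v w') :
    w = w' := by
  ext1
  · rw [h.spec.1, h'.spec.1]
  · funext a
    rw [h.spec.2, h'.spec.2]

/-- The subword of `w` on the positions `a + 1, …, b` (empty unless `0 ≤ a ≤ b ≤ |w|`). -/
def slice (w : LWord Λ X) (a b : Λ) : LWord Λ X :=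
  if h : 0 ≤ a ∧ a ≤ b ∧ b ≤ w.len then
    { len := b - a
      letter := fun i => if 1 ≤ i ∧ i ≤ b - a then w.letter (a + i) else none
      len_nonneg := sub_nonneg.2 h.2.1
      isSome_iff := fun i => by
        split_ifs with hi
        · rw [w.isSome_iff]
          exact ⟨fun _ => hi, fun _ => ⟨hi.1.trans (le_add_of_nonneg_left h.1),
            (le_sub_iff_add_le'.1 hi.2).trans h.2.2⟩⟩
        · simp [hi] }
  else empty

section Slice

variable {w : LWord Λ X} {a b : Λ}

theorem slice_len (h0 : 0 ≤ a) (h1 : a ≤ b) (h2 : b ≤ w.len) : (w.slice a b).len = b - a := by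
  rw [slice, dif_pos ⟨h0, h1, h2⟩]

theorem slice_letter_eq_ite (h0 : 0 ≤ a) (h1 : a ≤ b) (h2 : b ≤ w.len) (i : Λ) :
    (w.slice a b).letter i = if 1 ≤ i ∧ i ≤ b - a then w.letter (a + i) else none := by
  rw [slice, dif_pos ⟨h0, h1, h2⟩]

theorem slice_letter (h0 : 0 ≤ a) (h2 : b ≤ w.len) {i : Λ} (hi : 1 ≤ i)
    (hi' : i ≤ b - a) : (w.slice a b).letter i = w.letter (a + i) := by
  rw [slice_letter_eq_ite h0 (sub_nonneg.1 ((one_pos'.le.trans hi).trans hi')) h2,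
    if_pos ⟨hi, hi'⟩]

theorem slice_zero_len (w : LWord Λ X) : w.slice 0 w.len = w := by
  ext1
  · rw [slice_len le_rfl w.len_nonneg le_rfl, sub_zero]
  · funext i
    rw [slice_letter_eq_ite le_rfl w.len_nonneg le_rfl, sub_zero, zero_add]
    split_ifs with h
    · rfl
    · exact (letter_eq_none h).symm

theorem slice_concat_slice {c : Λ} (h0 : 0 ≤ a) (h1 : a ≤ c) (h2 : c ≤ b) (h3 : b ≤ w.len) :
    (w.slice a c).concat (w.slice c b) = w.slice a b := by
  ext1
  · change (w.slice a c).len + (w.slice c b).len = _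
    rw [slice_len h0 h1 (h2.trans h3), slice_len (h0.trans h1) h2 h3,
      slice_len h0 (h1.trans h2) h3]
    abel
  · funext i
    change (if i ≤ (w.slice a c).len then (w.slice a c).letter i
      else (w.slice c b).letter (i - (w.slice a c).len)) = _
    rw [slice_len h0 h1 (h2.trans h3), slice_letter_eq_ite h0 h1 (h2.trans h3),
      slice_letter_eq_ite (h0.trans h1) h2 h3, slice_letter_eq_ite h0 (h1.trans h2) h3]
    have e : c + (i - (c - a)) = a + i := by abel
    rw [e]
    by_cases hi : i ≤ c - a
    · have : i ≤ b - a := hi.trans (sub_le_sub_right h2 a)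
      simp [hi, this]
    · have hi' := not_le.1 hi
      have hp : 1 ≤ i := one_le_iff.2 ((sub_nonneg.2 h1).trans_lt hi')
      have hq : 1 ≤ i - (c - a) := one_le_iff.2 (sub_pos.2 hi')
      have hr : i - (c - a) ≤ b - c ↔ i ≤ b - a := by
        rw [sub_le_iff_le_add]
        simp
      simp [hi, hp, hq, hr]

theorem slice_congr {v : LWord Λ X} {c r : Λ} (h0 : 0 ≤ a) (hc : 0 ≤ c) (hr : 0 ≤ r)
    (h1 : a + r ≤ w.len) (h2 : c + r ≤ v.len)
    (h : ∀ i, 1 ≤ i → i ≤ r → w.letter (a + i) = v.letter (c + i)) :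
    w.slice a (a + r) = v.slice c (c + r) := by
  have ha := le_add_of_nonneg_right (a := a) hr
  have hc' := le_add_of_nonneg_right (a := c) hr
  ext1
  · rw [slice_len h0 ha h1, slice_len hc hc' h2]
    abel
  · funext i
    rw [slice_letter_eq_ite h0 ha h1, slice_letter_eq_ite hc hc' h2, add_sub_cancel_left,
      add_sub_cancel_left]
    split_ifs with hi
    · exact h i hi.1 hi.2
    · rfl

theorem slice_inv (h0 : 0 ≤ a) (h1 : a ≤ b) (h2 : b ≤ w.len) :
    (w.slice a b).inv = w.inv.slice (w.len - b) (w.len - a) := by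
  have k0 : 0 ≤ w.len - b := sub_nonneg.2 h2
  have k1 : w.len - b ≤ w.len - a := sub_le_sub_left h1 _
  have k2 : w.len - a ≤ w.inv.len := sub_le_self _ h0
  have e : w.len - a - (w.len - b) = b - a := by abel
  ext1
  · change (w.slice a b).len = _
    rw [slice_len h0 h1 h2, slice_len k0 k1 k2, e]
  · funext i
    change Option.map _ ((w.slice a b).letter ((w.slice a b).len + 1 - i)) = _
    rw [slice_len h0 h1 h2, slice_letter_eq_ite h0 h1 h2, slice_letter_eq_ite k0 k1 k2, e]
    -- The reflection `i ↦ b - a + 1 - i` maps the positions `1, …, b - a` to themselves, exchanging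
    -- the two bounds.
    have hiff : (1 ≤ b - a + 1 - i ∧ b - a + 1 - i ≤ b - a) ↔ (1 ≤ i ∧ i ≤ b - a) := by
      rw [and_comm, sub_le_iff_le_add, add_le_add_iff_left, le_sub_comm (a := 1), add_sub_cancel_right]
    simp only [hiff]
    split_ifs with hi
    · change _ = Option.map _ (w.letter (w.len + 1 - (w.len - b + i)))
      congr 2
      abel
    · rfl

end Slice

end LWord

/-! ### Lists of segments: comparison, inversion, multiplication and reading of letters. -/

/-- A segment `(p, a, b)` stands for the subword on `a + 1, …, b` of the `p`-th word of a
family. -/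
abbrev Segment (I Λ : Type*) := I × Λ × Λ

namespace Segment

open DiscretelyOrdered LWord

variable {Λ : Type*} [AddCommGroup Λ] [LinearOrder Λ] {I : Type*}

/-- The length of a segment. -/
def length (s : Segment I Λ) : Λ := s.2.2 - s.2.1

/-- What remains of a segment when an initial part of length `r` is removed, as a list of at most
one segment. -/
def drop (s : Segment I Λ) (r : Λ) : List (Segment I Λ) :=
  if r < s.length then [(s.1, s.2.1 + r, s.2.2)] else []

/-- One step of the comparison of two lists of segments. The state consists of the length already
compared and of the remaining lists; `C` gives the lengths of the common initial segments of
tails. -/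
def compareStep [One Λ] (C : I × Λ → I × Λ → Λ)
    (st : Λ × List (Segment I Λ) × List (Segment I Λ)) :
    Λ × List (Segment I Λ) × List (Segment I Λ) :=
  Option.casesOn st.2.1.head? st fun s => Option.casesOn st.2.2.head? st fun t =>
    (st.1 + min (C (s.1, s.2.1 + 1) (t.1, t.2.1 + 1)) (min s.length t.length),
      s.drop (min (C (s.1, s.2.1 + 1) (t.1, t.2.1 + 1)) (min s.length t.length)) ++ st.2.1.tail,
      t.drop (min (C (s.1, s.2.1 + 1) (t.1, t.2.1 + 1)) (min s.length t.length)) ++ st.2.2.tail)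

/-- The comparison of two lists of segments: the length of the longest common initial segment of
the words they stand for, and what remains of them after it. -/
def compare [One Λ] (C : I × Λ → I × Λ → Λ) (A B : List (Segment I Λ)) :
    Λ × List (Segment I Λ) × List (Segment I Λ) :=
  (compareStep C)^[A.length + B.length] (0, A, B)

variable [IsOrderedAddMonoid Λ] [DiscretelyOrdered Λ] {X : Type*} (W : I → LWord Λ X)

/-- The segment is nonempty and lies in its word. -/
def Valid (s : Segment I Λ) : Prop := 0 ≤ s.2.1 ∧ s.2.1 < s.2.2 ∧ s.2.2 ≤ (W s.1).len

/-- The word that a list of segments stands for. -/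
def toWord : List (Segment I Λ) → LWord Λ X
  | [] => empty
  | s :: L => ((W s.1).slice s.2.1 s.2.2).concat (toWord L)

theorem toWord_append (A B : List (Segment I Λ)) :
    toWord W (A ++ B) = (toWord W A).concat (toWord W B) := by
  induction A with
  | nil => exact (empty_concat _).symm
  | cons s A ih => rw [List.cons_append, toWord, toWord, ih, concat_assoc]

variable {W}

theorem Valid.length_pos {s : Segment I Λ} (h : s.Valid W) : 0 < s.length := sub_pos.2 h.2.1

theorem Valid.slice_len {s : Segment I Λ} (h : s.Valid W) :
    ((W s.1).slice s.2.1 s.2.2).len = s.length := LWord.slice_len h.1 h.2.1.le h.2.2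

theorem Valid.toWord_len {s : Segment I Λ} (h : s.Valid W) (L : List (Segment I Λ)) :
    (toWord W (s :: L)).len = s.length + (toWord W L).len := by
  rw [← h.slice_len]; rfl

theorem Valid.toWord_len_pos {s : Segment I Λ} (h : s.Valid W) (L : List (Segment I Λ)) :
    0 < (toWord W (s :: L)).len := by
  rw [h.toWord_len]
  exact add_pos_of_pos_of_nonneg h.length_pos (toWord W L).len_nonneg

theorem Valid.toWord_letter_one {s : Segment I Λ} (h : s.Valid W) (L : List (Segment I Λ)) :
    (toWord W (s :: L)).letter 1 = (W s.1).letter (s.2.1 + 1) := by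
  have h1 := one_le_iff.2 h.length_pos
  rw [toWord, concat_letter_of_le (by rwa [h.slice_len]), slice_letter h.1 h.2.2 le_rfl h1]

theorem Valid.drop_valid {s : Segment I Λ} (h : s.Valid W) {r : Λ} (hr : 0 ≤ r) :
    ∀ t ∈ s.drop r, t.Valid W := by
  intro t ht
  rw [drop] at ht
  split_ifs at ht with hlt
  · rw [List.mem_singleton] at ht
    subst ht
    exact ⟨add_nonneg h.1 hr, by rwa [← lt_sub_iff_add_lt'], h.2.2⟩
  · simp at ht

/-- This splits the head of a list at a matched length. When `r` is the whole length, `drop` returns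
no segment instead of an empty one, so remaining segments stay nonempty and a nonempty list always
stands for a nonempty word. -/
theorem Valid.slice_concat_drop {s : Segment I Λ} (h : s.Valid W) {r : Λ} (hr : 0 ≤ r)
    (hrs : r ≤ s.length) (L : List (Segment I Λ)) :
    toWord W (s :: L) =
      ((W s.1).slice s.2.1 (s.2.1 + r)).concat (toWord W (s.drop r ++ L)) := by
  have hle : s.2.1 + r ≤ s.2.2 := by rwa [← le_sub_iff_add_le']
  rw [toWord, drop]
  split_ifs with hlt
  · rw [List.singleton_append, toWord, ← concat_assoc,
      slice_concat_slice h.1 (le_add_of_nonneg_right hr) hle h.2.2]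
  · have e : r = s.length := le_antisymm hrs (not_lt.1 hlt)
    rw [e, length, add_sub_cancel, List.nil_append]

/-- `C` computes the lengths of the common initial segments of the tails of the words `W p`; the
tails are given by the positions preceding them. -/
def ComparesTails (W : I → LWord Λ X) (C : I × Λ → I × Λ → Λ) : Prop :=
  ∀ p q a b, 0 ≤ a → a < (W p).len → 0 ≤ b → b < (W q).len →
    0 ≤ C (p, a + 1) (q, b + 1) ∧
    (∀ i, 1 ≤ i → i ≤ C (p, a + 1) (q, b + 1) → (W p).letter (a + i) = (W q).letter (b + i)) ∧
    (a + C (p, a + 1) (q, b + 1) < (W p).len → b + C (p, a + 1) (q, b + 1) < (W q).len →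
      (W p).letter (a + C (p, a + 1) (q, b + 1) + 1) ≠
        (W q).letter (b + C (p, a + 1) (q, b + 1) + 1))

/-- The properties of a state of the comparison of `u` and `v`. -/
structure IsState (W : I → LWord Λ X) (u v : LWord Λ X)
    (st : Λ × List (Segment I Λ) × List (Segment I Λ)) : Prop where
  valid_left : ∀ s ∈ st.2.1, s.Valid W
  valid_right : ∀ s ∈ st.2.2, s.Valid W
  exists_common : ∃ z : LWord Λ X, z.len = st.1 ∧ u = z.concat (toWord W st.2.1) ∧
    v = z.concat (toWord W st.2.2)

variable {C : I × Λ → I × Λ → Λ}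

theorem compareStep_cons (n : Λ) (s t : Segment I Λ) (A B : List (Segment I Λ)) :
    compareStep C (n, s :: A, t :: B) =
      (n + min (C (s.1, s.2.1 + 1) (t.1, t.2.1 + 1)) (min s.length t.length),
      s.drop (min (C (s.1, s.2.1 + 1) (t.1, t.2.1 + 1)) (min s.length t.length)) ++ A,
      t.drop (min (C (s.1, s.2.1 + 1) (t.1, t.2.1 + 1)) (min s.length t.length)) ++ B) := rfl

/-- The matched part of length `r` moves from both heads to the common prefix `z`. The cut by the
segment lengths is needed because `C` compares tails running to the end of their generators, whereas
segments may stop earlier. -/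
theorem IsState.compareStep (hC : ComparesTails W C) {u v : LWord Λ X}
    {st : Λ × List (Segment I Λ) × List (Segment I Λ)} (h : IsState W u v st) :
    IsState W u v (compareStep C st) := by
  obtain ⟨n, A, B⟩ := st
  rcases A with - | ⟨s, A⟩
  · exact h
  rcases B with - | ⟨t, B⟩
  · exact h
  obtain ⟨hs, hA⟩ := List.forall_mem_cons.1 h.valid_left
  obtain ⟨ht, hB⟩ := List.forall_mem_cons.1 h.valid_right
  obtain ⟨z, hz, hu, hv⟩ := h.exists_common
  rw [compareStep_cons]
  obtain ⟨c0, c1, -⟩ := hC s.1 t.1 s.2.1 t.2.1 hs.1 (hs.2.1.trans_le hs.2.2) ht.1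
    (ht.2.1.trans_le ht.2.2)
  set k := C (s.1, s.2.1 + 1) (t.1, t.2.1 + 1)
  set r := min k (min s.length t.length)
  have hr : 0 ≤ r := le_min c0 (le_min hs.length_pos.le ht.length_pos.le)
  have hrs : r ≤ s.length := (min_le_right _ _).trans (min_le_left _ _)
  have hrt : r ≤ t.length := (min_le_right _ _).trans (min_le_right _ _)
  have hsl : s.2.1 + r ≤ (W s.1).len := (le_sub_iff_add_le'.1 hrs).trans hs.2.2
  -- The matched parts of the two heads are the same word, so one extension of `z` serves both `u`
  -- and `v`.
  have e : (W s.1).slice s.2.1 (s.2.1 + r) = (W t.1).slice t.2.1 (t.2.1 + r) :=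
    slice_congr hs.1 ht.1 hr hsl ((le_sub_iff_add_le'.1 hrt).trans ht.2.2)
      fun i h1 h2 => c1 i h1 (h2.trans (min_le_left _ _))
  refine ⟨?_, ?_, z.concat ((W s.1).slice s.2.1 (s.2.1 + r)), ?_, ?_, ?_⟩
  · intro x hx
    exact (List.mem_append.1 hx).elim (hs.drop_valid hr x) (hA x)
  · intro x hx
    exact (List.mem_append.1 hx).elim (ht.drop_valid hr x) (hB x)
  · change z.len + ((W s.1).slice s.2.1 (s.2.1 + r)).len = n + r
    rw [hz, LWord.slice_len hs.1 (le_add_of_nonneg_right hr) hsl, add_sub_cancel_left]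
  · rw [hu, concat_assoc, hs.slice_concat_drop hr hrs]
  · rw [hv, concat_assoc, e, ht.slice_concat_drop hr hrt]

/-- `compare` performs a number of steps fixed in advance, so a state in which the comparison is
already finished must be stationary. -/
theorem compareStep_eq_self (hC : ComparesTails W C)
    {st : Λ × List (Segment I Λ) × List (Segment I Λ)} (hl : ∀ s ∈ st.2.1, s.Valid W)
    (hr : ∀ s ∈ st.2.2, s.Valid W) (h : (toWord W st.2.1).Diverge (toWord W st.2.2)) :
    Segment.compareStep C st = st := by
  obtain ⟨n, A, B⟩ := st
  rcases A with - | ⟨s, A⟩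
  · rfl
  rcases B with - | ⟨t, B⟩
  · rfl
  obtain ⟨hs, hA⟩ := List.forall_mem_cons.1 hl
  obtain ⟨ht, hB⟩ := List.forall_mem_cons.1 hr
  have hd : (W s.1).letter (s.2.1 + 1) ≠ (W t.1).letter (t.2.1 + 1) := by
    rcases h with h | h | h
    · exact absurd h (hs.toWord_len_pos A).ne'
    · exact absurd h (ht.toWord_len_pos B).ne'
    · dsimp only at h
      rwa [hs.toWord_letter_one, ht.toWord_letter_one] at h
  obtain ⟨c0, c1, -⟩ := hC s.1 t.1 s.2.1 t.2.1 hs.1 (hs.2.1.trans_le hs.2.2) ht.1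
    (ht.2.1.trans_le ht.2.2)
  -- A positive common length would make the first letters agree, against divergence.
  have hk : C (s.1, s.2.1 + 1) (t.1, t.2.1 + 1) = 0 :=
    le_antisymm (not_lt.1 fun hlt => hd (c1 1 le_rfl (one_le_iff.2 hlt))) c0
  have hm := le_min hs.length_pos.le ht.length_pos.le
  rw [compareStep_cons, hk, min_eq_left hm, drop, drop, if_pos hs.length_pos,
    if_pos ht.length_pos]
  simp

/-- This gives termination. If the common length `k` of the tails ends strictly inside both heads,
the next letters differ. Otherwise the shorter head is matched completely and disappears, while the
other head leaves at most one segment. If one list is empty, the words already diverge. -/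
theorem diverge_or_length_lt_of_compareStep (hC : ComparesTails W C)
    {st : Λ × List (Segment I Λ) × List (Segment I Λ)} (hl : ∀ s ∈ st.2.1, s.Valid W)
    (hr : ∀ s ∈ st.2.2, s.Valid W) :
    (toWord W (compareStep C st).2.1).Diverge (toWord W (compareStep C st).2.2) ∨
      (compareStep C st).2.1.length + (compareStep C st).2.2.length <
        st.2.1.length + st.2.2.length := by
  obtain ⟨n, A, B⟩ := st
  rcases A with - | ⟨s, A⟩
  · exact .inl (.inl rfl)
  rcases B with - | ⟨t, B⟩
  · exact .inl (.inr (.inl rfl))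
  obtain ⟨hs, hA⟩ := List.forall_mem_cons.1 hl
  obtain ⟨ht, hB⟩ := List.forall_mem_cons.1 hr
  rw [compareStep_cons]
  obtain ⟨c0, -, c2⟩ := hC s.1 t.1 s.2.1 t.2.1 hs.1 (hs.2.1.trans_le hs.2.2) ht.1
    (ht.2.1.trans_le ht.2.2)
  set k := C (s.1, s.2.1 + 1) (t.1, t.2.1 + 1)
  have hdrop : ∀ (x : Segment I Λ) (r : Λ), (x.drop r).length ≤ 1 := fun x r => by
    rw [drop]; split_ifs <;> simp
  by_cases hk : k < s.length ∧ k < t.length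
  · left
    have e : min k (min s.length t.length) = k := min_eq_left (le_min hk.1.le hk.2.le)
    have hks : s.2.1 + k < s.2.2 := lt_sub_iff_add_lt'.1 hk.1
    have hkt : t.2.1 + k < t.2.2 := lt_sub_iff_add_lt'.1 hk.2
    have hs' : Valid W ((s.1, s.2.1 + k, s.2.2) : Segment I Λ) := ⟨add_nonneg hs.1 c0, hks, hs.2.2⟩
    have ht' : Valid W ((t.1, t.2.1 + k, t.2.2) : Segment I Λ) := ⟨add_nonneg ht.1 c0, hkt, ht.2.2⟩
    refine .inr (.inr ?_)
    rw [e, drop, drop, if_pos hk.1, if_pos hk.2, List.singleton_append, List.singleton_append,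
      hs'.toWord_letter_one, ht'.toWord_letter_one]
    exact c2 (hks.trans_le hs.2.2) (hkt.trans_le ht.2.2)
  · right
    have h1 := hdrop s (min k (min s.length t.length))
    have h2 := hdrop t (min k (min s.length t.length))
    -- If `k` reaches the end of either head, the matched length is that of the shorter head, whose
    -- `drop` is then empty.
    have h3 : (s.drop (min k (min s.length t.length))).length = 0 ∨
        (t.drop (min k (min s.length t.length))).length = 0 := by
      rw [not_and_or, not_lt, not_lt] at hk
      have hle : s.length ≤ min k (min s.length t.length) ∨
          t.length ≤ min k (min s.length t.length) := by
        rcases le_total s.length t.length with hst | hst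
        · rcases hk with hk | hk
          · exact .inl (le_min hk (le_min le_rfl hst))
          · exact .inl (le_min (hst.trans hk) (le_min le_rfl hst))
        · rcases hk with hk | hk
          · exact .inr (le_min (hst.trans hk) (le_min hst le_rfl))
          · exact .inr (le_min hk (le_min hst le_rfl))
      refine hle.imp (fun h => ?_) (fun h => ?_) <;> rw [drop, if_neg h.not_gt, List.length_nil]
    simp only [List.length_append, List.length_cons]
    omega

/-- The disjunction in the hypothesis is what the induction carries: either the remaining steps
still bound the number of segments, or divergence has occurred and the state no longer changes. With
no steps left, the first alternative means that both lists are empty. -/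
theorem IsState.iterate (hC : ComparesTails W C) {u v : LWord Λ X} (n : ℕ) :
    ∀ {st : Λ × List (Segment I Λ) × List (Segment I Λ)}, IsState W u v st →
      (st.2.1.length + st.2.2.length ≤ n ∨ (toWord W st.2.1).Diverge (toWord W st.2.2)) →
      IsState W u v ((Segment.compareStep C)^[n] st) ∧
        (toWord W ((Segment.compareStep C)^[n] st).2.1).Diverge
          (toWord W ((Segment.compareStep C)^[n] st).2.2) := by
  induction n with
  | zero =>
    intro st h hn
    refine ⟨h, hn.elim (fun hn => .inl ?_) id⟩
    have : st.2.1 = [] := List.eq_nil_of_length_eq_zero (by omega)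
    change (toWord W st.2.1).len = 0
    rw [this]
    rfl
  | succ n ih =>
    intro st h hn
    rw [Function.iterate_succ_apply]
    refine ih (h.compareStep hC) ?_
    rcases hn with hn | hn
    · rcases diverge_or_length_lt_of_compareStep hC h.valid_left h.valid_right with h' | h'
      · exact .inr h'
      · exact .inl (by omega)
    · exact .inr (by rwa [compareStep_eq_self hC h.valid_left h.valid_right hn])

theorem compare_spec (hC : ComparesTails W C) {A B : List (Segment I Λ)}
    (hA : ∀ s ∈ A, s.Valid W) (hB : ∀ s ∈ B, s.Valid W) :
    IsState W (toWord W A) (toWord W B) (compare C A B) ∧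
      (toWord W (compare C A B).2.1).Diverge (toWord W (compare C A B).2.2) :=
  IsState.iterate hC _ ⟨hA, hB, empty, rfl, (empty_concat _).symm, (empty_concat _).symm⟩
    (.inl le_rfl)

theorem compare_fst (hC : ComparesTails W C) {A B : List (Segment I Λ)}
    (hA : ∀ s ∈ A, s.Valid W) (hB : ∀ s ∈ B, s.Valid W) :
    (compare C A B).1 = comLen (toWord W A) (toWord W B) := by
  obtain ⟨⟨-, -, z, hz, h1, h2⟩, hd⟩ := compare_spec hC hA hB
  rw [IsCom.comLen_eq ⟨_, _, h1, h2, hd⟩, hz]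

/-- The segments of the inverse word, where `W (σ p)` is the inverse of `W p` and `ℓ p` is its
length. -/
def invList (σ : I → I) (ℓ : I → Λ) (L : List (Segment I Λ)) : List (Segment I Λ) :=
  (L.map fun s => (σ s.1, ℓ s.1 - s.2.2, ℓ s.1 - s.2.1)).reverse

theorem invList_valid {σ : I → I} (hσ : ∀ p, W (σ p) = (W p).inv) {L : List (Segment I Λ)}
    (hL : ∀ s ∈ L, s.Valid W) : ∀ s ∈ invList σ (fun p => (W p).len) L, s.Valid W := by
  intro s hs
  obtain ⟨t, ht, rfl⟩ := List.mem_map.1 (List.mem_reverse.1 hs)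
  obtain ⟨h0, h1, h2⟩ := hL t ht
  refine ⟨sub_nonneg.2 h2, sub_lt_sub_left h1 _, ?_⟩
  dsimp only
  rw [hσ]
  exact sub_le_self _ h0

theorem toWord_invList {σ : I → I} (hσ : ∀ p, W (σ p) = (W p).inv) {L : List (Segment I Λ)}
    (hL : ∀ s ∈ L, s.Valid W) :
    toWord W (invList σ (fun p => (W p).len) L) = (toWord W L).inv := by
  induction L with
  | nil => rfl
  | cons s L ih =>
    obtain ⟨hs, hL⟩ := List.forall_mem_cons.1 hL
    have := ih hL
    rw [invList] at this ⊢
    rw [List.map_cons, List.reverse_cons, toWord_append, this, toWord, toWord, toWord, inv_concat,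
      slice_inv hs.1 hs.2.1.le hs.2.2, concat_empty, hσ]

/-- The segments of the product of the words given by two lists of segments. -/
def mulList (C : I × Λ → I × Λ → Λ) (σ : I → I) (ℓ : I → Λ) (A B : List (Segment I Λ)) :
    List (Segment I Λ) :=
  invList σ ℓ (compare C (invList σ ℓ A) B).2.1 ++ (compare C (invList σ ℓ A) B).2.2

theorem mulList_valid (hC : ComparesTails W C) {σ : I → I} (hσ : ∀ p, W (σ p) = (W p).inv)
    {A B : List (Segment I Λ)} (hA : ∀ s ∈ A, s.Valid W) (hB : ∀ s ∈ B, s.Valid W) :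
    ∀ s ∈ mulList C σ (fun p => (W p).len) A B, s.Valid W := by
  have h := (compare_spec hC (invList_valid hσ hA) hB).1
  exact fun s hs => (List.mem_append.1 hs).elim (invList_valid hσ h.valid_left s) (h.valid_right s)

/-- Comparing the inverse of the first word with the second yields the common prefix `z` and
divergent remainders, which are precisely the data in the definition of `*`; inverting the first
remainder gives the product. -/
theorem isProd_mulList (hC : ComparesTails W C) {σ : I → I} (hσ : ∀ p, W (σ p) = (W p).inv)
    {A B : List (Segment I Λ)} (hA : ∀ s ∈ A, s.Valid W) (hB : ∀ s ∈ B, s.Valid W) :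
    IsProd (toWord W A) (toWord W B) (toWord W (mulList C σ (fun p => (W p).len) A B)) := by
  obtain ⟨⟨hl, -, z, -, h1, h2⟩, hd⟩ := compare_spec hC (invList_valid hσ hA) hB
  rw [toWord_invList hσ hA] at h1
  exact ⟨z, _, _, h1, h2, hd, by rw [mulList, toWord_append, toWord_invList hσ hl]⟩

/-- The list of segments of a single word `W p` of length `ℓ p`. -/
def single (ℓ : I → Λ) (p : I) : List (Segment I Λ) := if 0 < ℓ p then [(p, 0, ℓ p)] else []

theorem single_valid (p : I) : ∀ s ∈ single (fun p => (W p).len) p, s.Valid W := by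
  intro s hs
  rw [single] at hs
  split_ifs at hs with h
  · rw [List.mem_singleton] at hs
    subst hs
    exact ⟨le_rfl, h, le_rfl⟩
  · simp at hs

theorem toWord_single (p : I) : toWord W (single (fun p => (W p).len) p) = W p := by
  rw [single]
  split_ifs with h
  · rw [toWord, toWord, concat_empty, slice_zero_len]
  · exact (eq_empty_of_len (le_antisymm (not_lt.1 h) (W p).len_nonneg)).symm

/-- The length of the word given by a list of segments. -/
def lengthList (L : List (Segment I Λ)) : Λ := L.foldr (fun s n => s.length + n) 0

theorem lengthList_eq {L : List (Segment I Λ)} (hL : ∀ s ∈ L, s.Valid W) :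
    lengthList L = (toWord W L).len := by
  induction L with
  | nil => rfl
  | cons s L ih =>
    obtain ⟨hs, hL⟩ := List.forall_mem_cons.1 hL
    rw [hs.toWord_len, ← ih hL]
    rfl

/-- One step of reading off a letter: the state consists of the position relative to the first
segment not yet visited, and of the letter already found. -/
def readStep (f : I → Λ → Option (Letter X)) (st : Λ × Option (Letter X)) (s : Segment I Λ) :
    Λ × Option (Letter X) :=
  (st.1 - s.length, if 0 < st.1 then if st.1 ≤ s.length then f s.1 (s.2.1 + st.1) else st.2
    else st.2)

/-- The relative position decreases by the length of each visited segment. It is nonpositive once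
the letter has been found, so later segments leave the stored value alone; the arbitrary `o` is
needed to express this in the induction. -/
theorem foldl_readStep {L : List (Segment I Λ)} (hL : ∀ s ∈ L, s.Valid W) :
    ∀ (i : Λ) (o : Option (Letter X)),
      (L.foldl (readStep fun p => (W p).letter) (i, o)).2 =
        if 0 < i ∧ i ≤ (toWord W L).len then (toWord W L).letter i else o := by
  induction L with
  | nil =>
    intro i o
    rw [if_neg fun h => (h.1.trans_le h.2).ne rfl]
    rfl
  | cons s L ih =>
    intro i o
    obtain ⟨hs, hL⟩ := List.forall_mem_cons.1 hL
    rw [List.foldl_cons, readStep, ih hL, hs.toWord_len]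
    dsimp only
    by_cases h0 : 0 < i
    · by_cases h1 : i ≤ s.length
      · have h2 : i ≤ s.length + (toWord W L).len :=
          h1.trans (le_add_of_nonneg_right (toWord W L).len_nonneg)
        rw [if_neg fun h => h.1.not_ge (sub_nonpos.2 h1), if_pos h0, if_pos h1, if_pos ⟨h0, h2⟩,
          toWord, concat_letter_of_le (by rwa [hs.slice_len]),
          slice_letter hs.1 hs.2.2 (one_le_iff.2 h0) h1]
      · have h1' := not_le.1 h1
        rw [toWord, concat_letter_of_lt (by rwa [hs.slice_len]), hs.slice_len]
        simp [h0, h1, h1', add_comm s.length]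
    · have h3 : ¬ s.length < i := fun h => h0 (hs.length_pos.trans h)
      simp [h0, h3]

theorem foldl_readStep_none {L : List (Segment I Λ)} (hL : ∀ s ∈ L, s.Valid W) (i : Λ) :
    (L.foldl (readStep fun p => (W p).letter) (i, none)).2 = (toWord W L).letter i := by
  rw [foldl_readStep hL]
  split_ifs with h
  · rfl
  · rw [letter_eq_none]
    rwa [one_le_iff]

end Segment

/-! ### Computability of the operations on lists of segments. -/

namespace Segment

open ComputableOrderedGroup Computable

variable {Λ : Type*} [AddCommGroup Λ] [LinearOrder Λ] [IsOrderedAddMonoid Λ]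
  [Primcodable Λ] [ComputableOrderedGroup Λ] {I : Type*} [Primcodable I]

theorem computable_length : Computable (length : Segment I Λ → Λ) :=
  computable_sub (snd.comp snd) (fst.comp snd)

theorem computable_drop : Computable₂ (drop : Segment I Λ → Λ → List (Segment I Λ)) :=
  ite (computable_lt snd (computable_length.comp fst))
    (list_cons.comp ((fst.comp fst).pair
      ((computable_add (fst.comp (snd.comp fst)) snd).pair (snd.comp (snd.comp fst)))) (const []))
    (const [])

variable {C : I × Λ → I × Λ → Λ}

theorem computable_compareStep [One Λ] (hC : Computable₂ C) : Computable (compareStep C) := by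
  have hs : Computable fun x : ((Λ × List (Segment I Λ) × List (Segment I Λ)) × Segment I Λ) ×
      Segment I Λ => x.1.2 := snd.comp fst
  have ht : Computable fun x : ((Λ × List (Segment I Λ) × List (Segment I Λ)) × Segment I Λ) ×
      Segment I Λ => x.2 := snd
  have hst : Computable fun x : ((Λ × List (Segment I Λ) × List (Segment I Λ)) × Segment I Λ) ×
      Segment I Λ => x.1.1 := fst.comp fst
  have hk := hC.comp ((fst.comp hs).pair (computable_add (fst.comp (snd.comp hs)) (const 1)))
    ((fst.comp ht).pair (computable_add (fst.comp (snd.comp ht)) (const 1)))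
  have hr := computable_min hk
    (computable_min (computable_length.comp hs) (computable_length.comp ht))
  exact option_casesOn (list_head?.comp (fst.comp snd)) Computable.id
    (option_casesOn (list_head?.comp (snd.comp (snd.comp fst))) fst
      ((computable_add (fst.comp hst) hr).pair
        ((list_append.comp (computable_drop.comp hs hr)
            (list_tail.comp (fst.comp (snd.comp hst)))).pair
          (list_append.comp (computable_drop.comp ht hr)
            (list_tail.comp (snd.comp (snd.comp hst)))))).to₂).to₂

theorem computable_compare [One Λ] (hC : Computable₂ C) : Computable₂ (compare C) :=
  nat_iterate
    (Primrec.nat_add.to_comp.comp (list_length.comp fst) (list_length.comp snd))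
    ((const 0).pair (fst.pair snd)) ((computable_compareStep hC).comp snd).to₂

theorem computable_invList {σ : I → I} {ℓ : I → Λ} (hσ : Computable σ) (hℓ : Computable ℓ) :
    Computable (invList σ ℓ) :=
  list_reverse.comp (list_map Computable.id ((hσ.comp (fst.comp snd)).pair
    ((computable_sub (hℓ.comp (fst.comp snd)) (snd.comp (snd.comp snd))).pair
      (computable_sub (hℓ.comp (fst.comp snd)) (fst.comp (snd.comp snd))))).to₂)

theorem computable_mulList [DiscretelyOrdered Λ] (hC : Computable₂ C) {σ : I → I} {ℓ : I → Λ} (hσ : Computable σ)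
    (hℓ : Computable ℓ) : Computable₂ (mulList C σ ℓ) := by
  have h : Computable fun x : List (Segment I Λ) × List (Segment I Λ) =>
      compare C (invList σ ℓ x.1) x.2 :=
    (computable_compare hC).comp ((computable_invList hσ hℓ).comp fst) snd
  exact list_append.comp ((computable_invList hσ hℓ).comp (fst.comp (snd.comp h)))
    (snd.comp (snd.comp h))

theorem computable_single {ℓ : I → Λ} (hℓ : Computable ℓ) : Computable (single ℓ) :=
  ite (computable_lt (const 0) hℓ)
    (list_cons.comp (Computable.id.pair ((const 0).pair hℓ)) (const [])) (const [])

theorem computable_lengthList : Computable (lengthList : List (Segment I Λ) → Λ) :=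
  list_foldr Computable.id (const 0)
    (computable_add (computable_length.comp (fst.comp snd)) (snd.comp snd)).to₂

theorem computable_foldl_readStep {X : Type*} [Primcodable X] {f : I → Λ → Option (Letter X)}
    (hf : Computable₂ f) :
    Computable₂ fun (L : List (Segment I Λ)) (i : Λ) => (L.foldl (readStep f) (i, none)).2 := by
  have hstep : Computable₂ fun (_ : List (Segment I Λ) × Λ)
      (x : (Λ × Option (Letter X)) × Segment I Λ) => readStep f x.1 x.2 := by
    have hi : Computable fun y : (List (Segment I Λ) × Λ) ×
        ((Λ × Option (Letter X)) × Segment I Λ) => y.2.1.1 := fst.comp (fst.comp snd)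
    have ho : Computable fun y : (List (Segment I Λ) × Λ) ×
        ((Λ × Option (Letter X)) × Segment I Λ) => y.2.1.2 := snd.comp (fst.comp snd)
    have hs : Computable fun y : (List (Segment I Λ) × Λ) ×
        ((Λ × Option (Letter X)) × Segment I Λ) => y.2.2 := snd.comp snd
    exact (computable_sub hi (computable_length.comp hs)).pair
      (ite (computable_lt (const 0) hi)
        (ite (computable_le hi (computable_length.comp hs))
          (hf.comp (fst.comp hs) (computable_add (fst.comp (snd.comp hs)) hi)) ho) ho)
  exact snd.comp (list_foldl fst (snd.pair (const none)) hstep)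

/-- This passes from (ER2), where a tail is named by its first position `α ≥ 1`, to segments, which
record the position `a = α - 1` preceding it. -/
theorem ComparesTails.of_isCom {Λ : Type*} [AddCommGroup Λ] [LinearOrder Λ]
    [IsOrderedAddMonoid Λ] [DiscretelyOrdered Λ] {X I : Type*} {W : I → LWord Λ X}
    {C : I × Λ → I × Λ → Λ}
    (h : ∀ (p q : I) (α β : Λ) (hα : α ∈ Set.Icc 1 (W p).len) (hβ : β ∈ Set.Icc 1 (W q).len),
      ∃ w, LWord.IsCom ((W p).tail α hα) ((W q).tail β hβ) w ∧ C (p, α) (q, β) = w.len) :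
    ComparesTails W C := by
  intro p q a b ha ha' hb hb'
  have hα : a + 1 ∈ Set.Icc 1 (W p).len :=
    ⟨le_add_of_nonneg_left ha, DiscretelyOrdered.add_one_le_iff.2 ha'⟩
  have hβ : b + 1 ∈ Set.Icc 1 (W q).len :=
    ⟨le_add_of_nonneg_left hb, DiscretelyOrdered.add_one_le_iff.2 hb'⟩
  obtain ⟨w, hw, e⟩ := h p q (a + 1) (b + 1) hα hβ
  have hlet : ∀ (p : I) (a : Λ) (hα : a + 1 ∈ Set.Icc 1 (W p).len) (i : Λ), 1 ≤ i →
      ((W p).tail (a + 1) hα).letter i = (W p).letter (a + i) := by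
    intro p a hα i hi
    have e : a + 1 + i - 1 = a + i := by abel
    rw [← e]
    exact if_pos hi
  have hlen : ∀ (p : I) (a : Λ) (hα : a + 1 ∈ Set.Icc 1 (W p).len),
      ((W p).tail (a + 1) hα).len = (W p).len - a := fun p a hα => add_sub_add_right_eq_sub _ _ _
  obtain ⟨-, -, h3, h4⟩ := hw.spec
  have h1 : 1 ≤ w.len + 1 := le_add_of_nonneg_left w.len_nonneg
  rw [e]
  refine ⟨w.len_nonneg, fun i hi hi' => ?_, fun k1 k2 => ?_⟩
  · have := h3 i hi'
    rwa [hlet _ _ _ _ hi, hlet _ _ _ _ hi] at this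
  · rw [hlen, hlen, hlet _ _ _ _ h1, hlet _ _ _ _ h1] at h4
    rw [add_assoc, add_assoc]
    exact h4 (lt_sub_iff_add_lt'.2 k1) (lt_sub_iff_add_lt'.2 k2)

end Segment

/-! ### Words in the generators and the segment lists of their values. -/

section NormalForm

variable {Λ : Type*} [AddCommGroup Λ] [LinearOrder Λ] [IsOrderedAddMonoid Λ] [DiscretelyOrdered Λ]
variable {X : Type*} {G : Type*} [Group G] {m : ℕ}

theorem genProd_cons (y : Fin m → G) (p : Fin m × Bool) (w : List (Fin m × Bool)) :
    genProd y (p :: w) = genProd y [p] * genProd y w := by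
  simp [genProd]

theorem genProd_append (y : Fin m → G) (u w : List (Fin m × Bool)) :
    genProd y (u ++ w) = genProd y u * genProd y w := by
  simp [genProd]

theorem genProd_singleton_inv (y : Fin m → G) (p : Fin m × Bool) :
    genProd y [(p.1, !p.2)] = (genProd y [p])⁻¹ := by
  obtain ⟨i, b⟩ := p
  cases b <;> simp [genProd]

/-- The formal inverse of a word in the generators. -/
def invWord (w : List (Fin m × Bool)) : List (Fin m × Bool) :=
  (w.map fun p => (p.1, !p.2)).reverse

theorem genProd_invWord (y : Fin m → G) (w : List (Fin m × Bool)) :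
    genProd y (invWord w) = (genProd y w)⁻¹ := by
  induction w with
  | nil => simp [invWord, genProd]
  | cons p w ih =>
    rw [invWord] at ih ⊢
    rw [List.map_cons, List.reverse_cons, genProd_append, ih, genProd_singleton_inv,
      genProd_cons y p w, mul_inv_rev]

theorem computable_invWord : Computable (invWord : List (Fin m × Bool) → _) :=
  Computable.list_reverse.comp (Computable.list_map Computable.id
    ((Computable.fst.comp Computable.snd).pair
      (Primrec.not.to_comp.comp (Computable.snd.comp Computable.snd))).to₂)

theorem exists_genProd_eq {y : Fin m → G} (hy : Subgroup.closure (Set.range y) = ⊤) (g : G) :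
    ∃ w, genProd y w = g := by
  have hg : g ∈ Subgroup.closure (Set.range y) := hy ▸ Subgroup.mem_top g
  induction hg using Subgroup.closure_induction with
  | mem x hx =>
    obtain ⟨i, rfl⟩ := hx
    exact ⟨[(i, true)], by simp [genProd]⟩
  | one => exact ⟨[], rfl⟩
  | mul a b _ _ ha hb =>
    obtain ⟨u, rfl⟩ := ha
    obtain ⟨w, rfl⟩ := hb
    exact ⟨u ++ w, genProd_append y u w⟩
  | inv a _ ha =>
    obtain ⟨u, rfl⟩ := ha
    exact ⟨invWord u, genProd_invWord y u⟩

open Segment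

/-- The segments of the value of a word in the generators, where `ℓ p` is the length of the
generator `p`. -/
def normalForm (C : (Fin m × Bool) × Λ → (Fin m × Bool) × Λ → Λ) (ℓ : Fin m × Bool → Λ)
    (w : List (Fin m × Bool)) : List (Segment (Fin m × Bool) Λ) :=
  w.foldr (fun p L => mulList C (fun p => (p.1, !p.2)) ℓ (single ℓ p) L) []

theorem computable_normalForm [Primcodable Λ] [ComputableOrderedGroup Λ]
    {C : (Fin m × Bool) × Λ → (Fin m × Bool) × Λ → Λ} (hC : Computable₂ C)
    (ℓ : Fin m × Bool → Λ) : Computable (normalForm C ℓ) := by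
  -- There are only finitely many generators, so their lengths and formal inverses are finite
  -- tables.
  have hℓ : Computable ℓ := (Primrec.dom_finite ℓ).to_comp
  have hσ : Computable fun p : Fin m × Bool => (p.1, !p.2) := (Primrec.dom_finite _).to_comp
  exact Computable.list_foldr Computable.id (Computable.const [])
    ((computable_mulList hC hσ hℓ).comp
      ((computable_single hℓ).comp (Computable.fst.comp Computable.snd))
      (Computable.snd.comp Computable.snd)).to₂

variable (ρ : WordGroup Λ X G) (y : Fin m → G)

theorem word_genProd_singleton_inv (p : Fin m × Bool) :
    ρ.word (genProd y [(p.1, !p.2)]) = (ρ.word (genProd y [p])).inv := by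
  rw [genProd_singleton_inv, ρ.map_inv]

variable {C : (Fin m × Bool) × Λ → (Fin m × Bool) × Λ → Λ}

/-- Induction on the word: the list built by `mulList` stands for a product of the words of the
generator and of the remaining word, and so does the word of their product in `G`; `IsProd.unique`
makes them equal. -/
theorem normalForm_spec (hC : ComparesTails (fun p => ρ.word (genProd y [p])) C)
    (w : List (Fin m × Bool)) :
    (∀ s ∈ normalForm C (fun p => (ρ.word (genProd y [p])).len) w,
      s.Valid fun p => ρ.word (genProd y [p])) ∧
    toWord (fun p => ρ.word (genProd y [p]))
      (normalForm C (fun p => (ρ.word (genProd y [p])).len) w) = ρ.word (genProd y w) := by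
  induction w with
  | nil => exact ⟨fun s hs => absurd hs List.not_mem_nil, ρ.map_one.symm⟩
  | cons p w ih =>
    have hσ := word_genProd_singleton_inv ρ y
    have hs := single_valid (W := fun p => ρ.word (genProd y [p])) p
    refine ⟨mulList_valid hC hσ hs ih.1, ?_⟩
    have h := isProd_mulList hC hσ hs ih.1
    rw [ih.2, toWord_single] at h
    rw [genProd_cons]
    exact h.unique (ρ.map_mul _ _)

end NormalForm

/-! ### Effectiveness of `Γ_G` and of the action. -/

section Effective

open ComputableOrderedGroup Computable

variable {Λ : Type*} [AddCommGroup Λ] [LinearOrder Λ] [IsOrderedAddMonoid Λ] [DiscretelyOrdered Λ]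
  [Primcodable Λ] [ComputableOrderedGroup Λ] {X : Type*} [Primcodable X] {G : Type*} [Group G]
  {ρ : WordGroup Λ X G} {m : ℕ} {y : Fin m → G}

open Segment in
-- Lengths, letters and values of `c` for arbitrary words in the generators are all read off from
-- these lists.
theorem IsEffectiveRep.exists_normalForm (hρ : IsEffectiveRep ρ y) :
    ∃ (C : (Fin m × Bool) × Λ → (Fin m × Bool) × Λ → Λ)
      (N : List (Fin m × Bool) → List (Segment (Fin m × Bool) Λ)),
      Computable₂ C ∧ Computable N ∧ ComparesTails (fun p => ρ.word (genProd y [p])) C ∧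
        ∀ w, (∀ s ∈ N w, s.Valid fun p => ρ.word (genProd y [p])) ∧
          toWord (fun p => ρ.word (genProd y [p])) (N w) = ρ.word (genProd y w) := by
  obtain ⟨C, hC, hcom⟩ := hρ.com_computable
  have h := ComparesTails.of_isCom (W := fun p => ρ.word (genProd y [p])) hcom
  exact ⟨C, _, hC, computable_normalForm hC _, h, normalForm_spec ρ y h⟩

theorem IsEffectiveRep.computable_len (hρ : IsEffectiveRep ρ y) :
    Computable fun w : List (Fin m × Bool) => ρ.len (genProd y w) := by
  obtain ⟨-, N, -, hN, -, h⟩ := hρ.exists_normalForm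
  refine (Segment.computable_lengthList.comp hN).of_eq fun w => ?_
  rw [Segment.lengthList_eq (h w).1, (h w).2]
  rfl

theorem IsEffectiveRep.computable_letter_singleton (hρ : IsEffectiveRep ρ y)
    (p : Fin m × Bool) : Computable (ρ.word (genProd y [p])).letter := by
  obtain ⟨i, b⟩ := p
  cases b with
  | true => simpa [genProd] using hρ.letter_computable i
  | false =>
    have hinv : Computable (Letter.inv : Letter X → Letter X) :=
      fst.pair (Primrec.not.to_comp.comp snd)
    have h := option_map ((hρ.letter_computable i).comp
      (computable_sub (const ((ρ.word (y i)).len + 1)) Computable.id)) (hinv.comp snd).to₂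
    have e : genProd y [(i, false)] = (y i)⁻¹ := by simp [genProd]
    rw [e, ρ.map_inv]
    exact h

theorem IsEffectiveRep.computable_letter (hρ : IsEffectiveRep ρ y) :
    Computable₂ fun (w : List (Fin m × Bool)) (a : Λ) => (ρ.word (genProd y w)).letter a := by
  obtain ⟨-, N, -, hN, -, h⟩ := hρ.exists_normalForm
  -- (ER1) gives a separate program for each generator; finiteness of the family makes the letters
  -- computable uniformly in the generator, as the fold requires.
  refine ((Segment.computable_foldl_readStep
    (uncurry_of_finite hρ.computable_letter_singleton)).comp (hN.comp fst) snd).of_eq fun x => ?_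
  rw [Segment.foldl_readStep_none (W := fun p => ρ.word (genProd y [p])) (h x.1).1, (h x.1).2]

theorem IsEffectiveRep.computable_c (hρ : IsEffectiveRep ρ y) :
    Computable₂ fun u w : List (Fin m × Bool) => ρ.c (genProd y u) (genProd y w) := by
  obtain ⟨C, N, hC, hN, hT, h⟩ := hρ.exists_normalForm
  refine (fst.comp ((Segment.computable_compare hC).comp (hN.comp fst) (hN.comp snd))).of_eq
    fun x => ?_
  rw [Segment.compare_fst hT (h x.1).1 (h x.2).1, (h x.1).2, (h x.2).2]
  rfl

theorem IsEffectiveRep.exists_enumeration (hρ : IsEffectiveRep ρ y) :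
    ∃ e : ℕ → Λ × List (Fin m × Bool), Computable e ∧
      (∀ n, ∃ v : ρ.Tree, Represents ρ y (e n) v) ∧
      (∀ v : ρ.Tree, ∃ n, Represents ρ y (e n) v) := by
  -- A pair that represents no point is replaced by the base point `(0, [])`, so the sequence is
  -- total and consists of representatives only.
  let check : Λ × List (Fin m × Bool) → Λ × List (Fin m × Bool) := fun r =>
    if 0 ≤ r.1 then if r.1 ≤ ρ.len (genProd y r.2) then r else (0, []) else (0, [])
  have hcheck : Computable check :=
    ite (computable_le (const 0) fst)
      (ite (computable_le fst (hρ.computable_len.comp snd)) Computable.id (const _)) (const _)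
  have hmem : ∀ r, 0 ≤ (check r).1 ∧ (check r).1 ≤ ρ.len (genProd y (check r).2) := by
    intro r
    dsimp only [check]
    split_ifs with h0 h1
    · exact ⟨h0, h1⟩
    all_goals exact ⟨le_rfl, (ρ.word _).len_nonneg⟩
  refine ⟨fun n => check ((Encodable.decode n).getD (0, [])),
    hcheck.comp (option_getD Computable.decode (const _)), fun n => ?_, fun v => ?_⟩
  · exact ⟨_, (hmem _).1, (hmem _).2, rfl⟩
  · induction v using Quotient.inductionOn with
    | h p =>
      obtain ⟨⟨a, g⟩, h0, h1⟩ := p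
      obtain ⟨w, rfl⟩ := exists_genProd_eq hρ.generates g
      refine ⟨Encodable.encode (a, w), ?_⟩
      have e : check (a, w) = (a, w) := by
        dsimp only [check]
        rw [if_pos h0, if_pos h1]
      dsimp only
      rw [Encodable.encodek, Option.getD_some, e]
      exact ⟨h0, h1, rfl⟩

/-- The relation `∼` is a comparison in `Λ` together with a bound by `c`. The condition `0 ≤ α` in
it holds for every representative and need not be tested. -/
theorem IsEffectiveRep.exists_decides_eq (hρ : IsEffectiveRep ρ y) :
    ∃ E : Λ × List (Fin m × Bool) → Λ × List (Fin m × Bool) → Bool, Computable₂ E ∧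
      ∀ r s (v v' : ρ.Tree), Represents ρ y r v → Represents ρ y s v' →
        (E r s = true ↔ v = v') := by
  refine ⟨fun r s => (decide (r.1 ≤ s.1) && decide (s.1 ≤ r.1)) &&
    decide (r.1 ≤ ρ.c (genProd y r.2) (genProd y s.2)), ?_, ?_⟩
  · exact Primrec.and.to_comp.comp
      (Primrec.and.to_comp.comp (computable_le (fst.comp fst) (fst.comp snd))
        (computable_le (fst.comp snd) (fst.comp fst)))
      (computable_le (fst.comp fst) (hρ.computable_c.comp (snd.comp fst) (snd.comp snd)))
  · rintro r s v v' ⟨h0, h1, rfl⟩ ⟨k0, k1, rfl⟩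
    rw [Bool.and_eq_true, Bool.and_eq_true, decide_eq_true_eq, decide_eq_true_eq,
      decide_eq_true_eq, ← le_antisymm_iff]
    refine Iff.trans ?_ Quotient.eq.symm
    exact ⟨fun h => ⟨h.1, h0, h.2⟩, fun h => ⟨h.1, h.2.2⟩⟩

theorem IsEffectiveRep.exists_computes_dist (hρ : IsEffectiveRep ρ y) :
    ∃ D : Λ × List (Fin m × Bool) → Λ × List (Fin m × Bool) → Λ, Computable₂ D ∧
      ∀ r s (v v' : ρ.Tree), Represents ρ y r v → Represents ρ y s v' →
        D r s = ρ.dist v v' := by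
  refine ⟨fun r s => r.1 + s.1 - 2 • min (min r.1 s.1) (ρ.c (genProd y r.2) (genProd y s.2)),
    ?_, ?_⟩
  · have hm := computable_min (computable_min (fst.comp fst) (fst.comp snd))
      (hρ.computable_c.comp (snd.comp fst) (snd.comp snd))
    -- The multiple by `2` becomes a sum, since addition is the operation known to be computable.
    simp only [two_nsmul]
    exact computable_sub (computable_add (fst.comp fst) (fst.comp snd)) (computable_add hm hm)
  · rintro r s v v' ⟨h0, h1, rfl⟩ ⟨k0, k1, rfl⟩
    rfl

theorem IsEffectiveRep.exists_computes_smul (hρ : IsEffectiveRep ρ y) :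
    ∃ A : List (Fin m × Bool) → Λ × List (Fin m × Bool) → Λ × List (Fin m × Bool), Computable₂ A ∧
      ∀ (u : List (Fin m × Bool)) r (v : ρ.Tree), Represents ρ y r v →
        Represents ρ y (A u r) (genProd y u • v) := by
  -- The formula for the action is applied to words: `invWord u` has value `f⁻¹`, and `u ++ r.2` has
  -- value `f * g`.
  refine ⟨fun u r =>
    (ρ.len (genProd y u) + r.1 - 2 • min r.1 (ρ.c (genProd y (invWord u)) (genProd y r.2)),
      if r.1 ≤ ρ.c (genProd y (invWord u)) (genProd y r.2) then u else u ++ r.2), ?_, ?_⟩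
  · have hc := hρ.computable_c.comp (computable_invWord.comp
      (fst (α := List (Fin m × Bool)) (β := Λ × List (Fin m × Bool)))) (snd.comp snd)
    have hm := computable_min (fst.comp snd) hc
    simp only [two_nsmul]
    exact (computable_sub (computable_add (hρ.computable_len.comp fst) (fst.comp snd))
      (computable_add hm hm)).pair
        (ite (computable_le (fst.comp snd) hc) fst (list_append.comp fst (snd.comp snd)))
  · rintro u ⟨a, w⟩ v ⟨h0, h1, rfl⟩
    dsimp only at h0 h1 ⊢
    rw [genProd_invWord]
    have hact : genProd y u • ρ.point a (genProd y w) h0 h1 =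
        ⟦ρ.actPre (genProd y u) ⟨(a, genProd y w), h0, h1⟩⟧ := rfl
    rw [hact]
    by_cases h : a ≤ ρ.c (genProd y u)⁻¹ (genProd y w)
    · have hmem := ρ.actPre_mem_left h0 h
      rw [if_pos h]
      refine ⟨hmem.1, hmem.2, ?_⟩
      rw [WordGroup.actPre, dif_pos h]
      rfl
    · have hmem := ρ.actPre_mem_right h1 h
      rw [if_neg h]
      refine ⟨hmem.1, by rw [genProd_append]; exact hmem.2, ?_⟩
      rw [WordGroup.actPre, dif_neg h]
      simp only [genProd_append]
      rfl

end Effective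

theorem mainTheorem4 {Λ : Type*} [AddCommGroup Λ] [LinearOrder Λ] [IsOrderedAddMonoid Λ]
    [DiscretelyOrdered Λ] [Primcodable Λ] [ComputableOrderedGroup Λ]
    {X : Type*} [Primcodable X] {G : Type*} [Group G] (ρ : WordGroup Λ X G)
    {m : ℕ} (y : Fin m → G) (hρ : IsEffectiveRep ρ y) :
    -- (1) the points of the tree are enumerated effectively, with their words and distances
    ((∃ e : ℕ → Λ × List (Fin m × Bool), Computable e ∧
        (∀ n, ∃ v : ρ.Tree, Represents ρ y (e n) v) ∧
        (∀ v : ρ.Tree, ∃ n, Represents ρ y (e n) v)) ∧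
      (Computable fun w : List (Fin m × Bool) => ρ.len (genProd y w)) ∧
      (Computable₂ fun (w : List (Fin m × Bool)) (a : Λ) => (ρ.word (genProd y w)).letter a) ∧
      (∃ E : Λ × List (Fin m × Bool) → Λ × List (Fin m × Bool) → Bool, Computable₂ E ∧
        ∀ r s (v v' : ρ.Tree), Represents ρ y r v → Represents ρ y s v' →
          (E r s = true ↔ v = v')) ∧
      (∃ D : Λ × List (Fin m × Bool) → Λ × List (Fin m × Bool) → Λ, Computable₂ D ∧
        ∀ r s (v v' : ρ.Tree), Represents ρ y r v → Represents ρ y s v' →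
          D r s = ρ.dist v v')) ∧
    -- (2) the action is effective
    (∃ A : List (Fin m × Bool) → Λ × List (Fin m × Bool) → Λ × List (Fin m × Bool), Computable₂ A ∧
      ∀ (u : List (Fin m × Bool)) r (v : ρ.Tree), Represents ρ y r v →
        Represents ρ y (A u r) (genProd y u • v)) := by
  exact ⟨⟨hρ.exists_enumeration, hρ.computable_len, hρ.computable_letter,
    hρ.exists_decides_eq, hρ.exists_computes_dist⟩, hρ.exists_computes_smul⟩
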